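/- Let $\Gamma$ be a countable discrete group with identity $e$, and let $\mu$ be a probability measure on $\Gamma$ with finite support $S_\mu=\{x:\mu(x)>0\}$. Write $\mu^{(n)}$ for the $n$-th convolution power of $\mu$. Assume that $\mu$ is irreducible, i.e. $\bigcup_{n\ge 1} S_\mu^n=\Gamma$ (where $S_\mu^n$ is the set of products of $n$ elements of $S_\mu$), and aperiodic, i.e. $\gcd\{n\ge 1:\mu^{(n)}(e)>0\}=1$. Let $\rho(\mu)=\limsup_{n\to\infty}\mu^{(n)}(e)^{1/n}$. A positive measure on $\Gamma$ means a measure that is finite at every point. Let (P) be a property of positive measures on $\Gamma$ such that - whenever a positive measure $\nu'$ and integers $n_1<n_2<\cdots$ satisfy $\mu^{(n_k)}(x)/\mu^{(n_k)}(e)\to\nu'(x)$ as $k\to\infty$ for every $x\in\Gamma$, the measure $\nu'$ has property (P); and - there is a unique positive measure $\nu$ on $\Gamma$ that has property (P) and satisfies $\nu(e)=1$ and $\mu*\nu=\rho(\mu)\,\nu$. Then $$\lim_{n\to\infty}\frac{\mu^{(n)}(x)}{\mu^{(n)}(e)}=\nu(x)\qquad\text{for all }x\in\Gamma.$$ -/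

import Mathlib

open MeasureTheory Filter
open scoped Topology ENNReal Pointwise

namespace RandomWalk

variable {Γ : Type*} [Group Γ] [MeasurableSpace Γ]

/-- The `n`-th convolution power `μ^(n)`, with `μ^(0)` the unit mass at the identity. -/
noncomputable def convPow (μ : Measure Γ) : ℕ → Measure Γ
  | 0 => Measure.dirac 1
  | n + 1 => μ ∗ₘ convPow μ n

/-- The support `{x : μ(x) > 0}` of a measure on a discrete group. -/
def supp (μ : Measure Γ) : Set Γ := {x | 0 < μ {x}}

/-- The random walk with law `μ` is irreducible: the semigroup generated by the support,
i.e. the union over `n ≥ 1` of the sets of all products of `n` elements of the support,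
is the whole group. -/
def IsIrreducible (μ : Measure Γ) : Prop :=
  ⋃ n : ℕ, ⋃ _ : 1 ≤ n, supp μ ^ n = Set.univ

/-- The period `gcd {n ≥ 1 : μ^(n)(e) > 0}`. -/
noncomputable def period (μ : Measure Γ) : ℕ :=
  Nat.setGcd {n : ℕ | 1 ≤ n ∧ 0 < convPow μ n {1}}

/-- The number `ρ(μ) = limsup μ^(n)(e)^(1/n)`, as an extended nonnegative real. -/
noncomputable def spectralRad (μ : Measure Γ) : ℝ≥0∞ :=
  limsup (fun n : ℕ => (convPow μ n {1}) ^ (1 / (n : ℝ))) atTop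

/-- The positive measure `ν` on the discrete group (finite at every point) satisfies `ν(e) = 1`
and `μ * ν = ρ(μ) ν`. -/
structure IsNormalizedSolution (μ ν : Measure Γ) : Prop where
  lt_top : ∀ x, ν {x} < ∞
  one : ν {1} = 1
  conv : μ ∗ₘ ν = spectralRad μ • ν

/-- The positive measure `ν` on the discrete group (finite at every point) is the pointwise limit
of a subsequence of the sequence of measures `μ^(n) / μ^(n)(e)`. -/
def IsSubseqLimit (μ ν : Measure Γ) : Prop :=
  (∀ x, ν {x} < ∞) ∧ ∃ φ : ℕ → ℕ, StrictMono φ ∧ ∀ x,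
    Tendsto (fun k => convPow μ (φ k) {x} / convPow μ (φ k) {1}) atTop (𝓝 (ν {x}))

end RandomWalk

/-! The space `Γ → ℝ≥0∞` is compact and metrizable, so it suffices that every subsequential limit
`w` of `μ^(n) / μ^(n)(e)` equals `ν`. By (P) and uniqueness this holds once `w` is finite and `μ * w
= ρ w`. Finiteness is a Harnack bound. The equation is the limit of `μ^(n+1) = μ * μ^(n)`, a finite
sum at each point, given the strong ratio limit `μ^(n+1)(x) / μ^(n)(x) → ρ`
(`exists_tendsto_coeff_succ_div`).

The ratio limit comes from convexity. View `μ` as an element `p` of the monoid algebra and write a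
power `p^k` charging `1` as `σ + ε • 1`. Let `A_n(t)` be the coefficient at `1` of `(σ + t • 1)^n *
τ`. Then `(1/n) log A_n(ε e^s)` is convex in `s`, with slope `ε A_{n-1}(ε) / A_n(ε)` at `s = 0`.
Adding a multiple of `1` shifts the growth rate `R`, so the limit is `log (R + ε e^s - ε)`. This is
differentiable, so the slopes converge to `ε / R`, that is, `A_{n+1}(ε) / A_n(ε) → R`. Suitable `τ`
reach every point and every residue mod `k`; two consecutive values of `k` then give the one-step
ratio. -/

namespace RandomWalk

/-! ### Convexity and ratios of binomial sums -/

/-- Bounds on the increments of `h` at `0` that hold asymptotically for the slopes `q n` force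
`q n` to converge to the derivative of `h` at `0`. -/
theorem tendsto_of_mul_le_increment {q : ℕ → ℝ} {h : ℝ → ℝ} {d : ℝ} (hd : HasDerivAt h d 0)
    (hq : ∀ s δ : ℝ, 0 < δ → ∀ᶠ n in atTop, q n * s ≤ h s - h 0 + δ) :
    Tendsto q atTop (𝓝 d) := by
  rw [Metric.tendsto_atTop']
  intro η hη
  have h1 := (hasDerivAt_iff_isLittleO.1 hd).def (half_pos hη)
  obtain ⟨r, hr, hball⟩ := Metric.eventually_nhds_iff.1 h1
  have hs0 : 0 < r / 2 := half_pos hr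
  set s := r / 2 with hs
  have hp := hball (y := s) (by rw [dist_zero_right, Real.norm_eq_abs, abs_of_pos hs0]; linarith)
  have hm := hball (y := -s)
    (by rw [dist_zero_right, Real.norm_eq_abs, abs_neg, abs_of_pos hs0]; linarith)
  simp only [sub_zero, smul_eq_mul, Real.norm_eq_abs, abs_neg, abs_of_pos hs0] at hp hm
  have hp' := (abs_le.1 hp).2
  have hm' := (abs_le.1 hm).2
  -- The derivative costs `η * s / 2`; a further `η * s / 4` keeps the total below `η * s`.
  have hδ : 0 < η * s / 4 := by positivity
  obtain ⟨N, hN⟩ := eventually_atTop.1 ((hq s _ hδ).and (hq (-s) _ hδ))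
  refine ⟨N, fun n hn => ?_⟩
  obtain ⟨h2, h3⟩ := hN n hn.le
  rw [Real.dist_eq, abs_lt]
  constructor
  · refine lt_of_mul_lt_mul_right (a := s) ?_ hs0.le
    nlinarith
  · refine lt_of_mul_lt_mul_right (a := s) ?_ hs0.le
    nlinarith

/-- The polynomial `∑ j ≤ n, C(n, j) t^(n-j) b j` attached to a sequence of coefficients. -/
def binomialSum (b : ℕ → ℝ) (n : ℕ) (t : ℝ) : ℝ :=
  ∑ j ∈ Finset.range (n + 1), (n.choose j : ℝ) * t ^ (n - j) * b j

/-- This is `t * A'_{n+1}(t) = (n + 1) * t * A_n(t)`: the sums form an Appell sequence. -/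
theorem sum_sub_mul_binomialSum (b : ℕ → ℝ) (n : ℕ) (t : ℝ) :
    ∑ j ∈ Finset.range (n + 2), ((n + 1).choose j : ℝ) * t ^ (n + 1 - j) * b j *
        ((n + 1 - j : ℕ) : ℝ) = (n + 1) * (t * binomialSum b n t) := by
  rw [Finset.sum_range_succ, Nat.sub_self, Nat.cast_zero, mul_zero, add_zero, binomialSum,
    Finset.mul_sum, Finset.mul_sum]
  refine Finset.sum_congr rfl fun j hj => ?_
  have hj' : j ≤ n := Nat.lt_succ_iff.1 (Finset.mem_range.1 hj)
  have h := congrArg (Nat.cast (R := ℝ)) (Nat.choose_mul_succ_eq n j)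
  push_cast at h
  have h2 : n + 1 - j = (n - j) + 1 := by omega
  rw [h2] at h ⊢
  rw [pow_succ]
  push_cast at h ⊢
  linear_combination (-(t ^ (n - j) * t * b j)) * h

/-- Jensen's inequality for the exponential: the logarithm of `binomialSum` as a function of
`log t` lies above its tangents. -/
theorem tangent_le_log_binomialSum {b : ℕ → ℝ} (hb : ∀ j, 0 ≤ b j) {ε : ℝ} (hε : 0 < ε) (n : ℕ)
    (hpos : 0 < binomialSum b (n + 1) ε) (s : ℝ) :
    (n + 1) * (ε * binomialSum b n ε / binomialSum b (n + 1) ε * s) +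
        Real.log (binomialSum b (n + 1) ε) ≤
      Real.log (binomialSum b (n + 1) (ε * Real.exp s)) := by
  set A := binomialSum b (n + 1) ε with hA
  -- `c` is the weighted mean of the exponents `(n + 1 - j) * s`, so the linear terms of the tangent
  -- at `c` cancel in the sum.
  set c := (n + 1) * (ε * binomialSum b n ε / A * s) with hc
  have key : Real.exp c * A ≤ binomialSum b (n + 1) (ε * Real.exp s) := by
    have h1 : ∀ j ∈ Finset.range (n + 2),
        Real.exp c * (((n + 1).choose j : ℝ) * ε ^ (n + 1 - j) * b j *
          (1 - c + s * ((n + 1 - j : ℕ) : ℝ))) ≤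
        ((n + 1).choose j : ℝ) * (ε * Real.exp s) ^ (n + 1 - j) * b j := by
      intro j _
      have h2 : Real.exp c * (1 - c + s * ((n + 1 - j : ℕ) : ℝ)) ≤ Real.exp s ^ (n + 1 - j) := by
        rw [← Real.exp_nat_mul]
        have h3 : Real.exp (((n + 1 - j : ℕ) : ℝ) * s) =
            Real.exp c * Real.exp (((n + 1 - j : ℕ) : ℝ) * s - c) := by
          rw [← Real.exp_add]; congr 1; ring
        rw [h3]
        refine mul_le_mul_of_nonneg_left ?_ (Real.exp_pos _).le
        have := Real.add_one_le_exp (((n + 1 - j : ℕ) : ℝ) * s - c)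
        linarith
      rw [mul_pow]
      have h4 : 0 ≤ ((n + 1).choose j : ℝ) * ε ^ (n + 1 - j) * b j :=
        mul_nonneg (by positivity) (hb j)
      have := mul_le_mul_of_nonneg_left h2 h4
      linarith
    have h5 := Finset.sum_le_sum h1
    rw [← Finset.mul_sum] at h5
    refine le_trans (le_of_eq ?_) h5
    congr 1
    have h6 := sum_sub_mul_binomialSum b n ε
    have h7 : ∑ j ∈ Finset.range (n + 2), (((n + 1).choose j : ℝ) * ε ^ (n + 1 - j) * b j *
          (1 - c + s * ((n + 1 - j : ℕ) : ℝ))) = (1 - c) * A +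
        s * ∑ j ∈ Finset.range (n + 2), ((n + 1).choose j : ℝ) * ε ^ (n + 1 - j) * b j *
        ((n + 1 - j : ℕ) : ℝ) := by
      rw [hA, binomialSum, Finset.mul_sum, Finset.mul_sum, ← Finset.sum_add_distrib]
      exact Finset.sum_congr rfl fun j _ => by ring
    rw [h7, h6, hc]
    field_simp
    ring
  calc c + Real.log A = Real.log (Real.exp c * A) := by
        rw [Real.log_mul (Real.exp_pos _).ne' hpos.ne', Real.log_exp]
    _ ≤ _ := Real.log_le_log (by positivity) key

/-- If the binomial sums grow like `R ^ n` at `ε` and no faster than `(R + t - ε) ^ n` at every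
`t > 0`, then the ratio of consecutive terms at `ε` converges to `R`. -/
theorem tendsto_binomialSum_ratio {b : ℕ → ℝ} (hb : ∀ j, 0 ≤ b j) {ε R : ℝ} (hε : 0 < ε)
    (hR : ε ≤ R) (hpos : ∀ n, 0 < binomialSum b n ε)
    (hup : ∀ t, 0 < t → ∃ C, 0 < C ∧ ∀ n, binomialSum b n t ≤ C * (R + t - ε) ^ n)
    (hlow : ∃ c, 0 < c ∧ ∃ l : ℕ → ℝ, Tendsto l atTop (𝓝 (Real.log R)) ∧
      ∀ n : ℕ, Real.log c + n * l n ≤ Real.log (binomialSum b n ε)) :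
    Tendsto (fun n => binomialSum b (n + 1) ε / binomialSum b n ε) atTop (𝓝 R) := by
  have hR0 : 0 < R := hε.trans_le hR
  obtain ⟨c, hc, l, hl, hlow⟩ := hlow
  set q : ℕ → ℝ := fun n => ε * binomialSum b n ε / binomialSum b (n + 1) ε with hqdef
  have hderiv : HasDerivAt (fun s => Real.log (R + ε * Real.exp s - ε)) (ε / R) 0 := by
    have h1 : HasDerivAt (fun s => R + ε * Real.exp s - ε) (ε * Real.exp 0) 0 :=
      (((Real.hasDerivAt_exp 0).const_mul ε).const_add R).sub_const ε
    have h2 := h1.log (by simp [hR0.ne'])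
    simpa using h2
  have hq : Tendsto q atTop (𝓝 (ε / R)) := by
    refine tendsto_of_mul_le_increment hderiv fun s δ hδ => ?_
    have ht : 0 < ε * Real.exp s := by positivity
    have hRt : 0 < R + ε * Real.exp s - ε := by linarith
    obtain ⟨C, hC, hup⟩ := hup _ ht
    -- The tangent inequality divided by `n + 1`: the constants `C` and `c` vanish in the limit.
    have hlim : Tendsto (fun n : ℕ => (Real.log C - Real.log c) * (1 / ((n : ℝ) + 1)) +
        Real.log (R + ε * Real.exp s - ε) - l (n + 1)) atTop
        (𝓝 ((Real.log C - Real.log c) * 0 + Real.log (R + ε * Real.exp s - ε) - Real.log R)) :=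
      ((tendsto_one_div_add_atTop_nhds_zero_nat.const_mul _).add_const _).sub
        (hl.comp (tendsto_add_atTop_nat 1))
    have hev := hlim.eventually_lt_const (u := Real.log (R + ε * Real.exp s - ε) -
      Real.log R + δ) (by linarith)
    filter_upwards [hev] with n hn
    have h1 := tangent_le_log_binomialSum hb hε n (hpos _) s
    have hb2 : 0 < binomialSum b (n + 1) (ε * Real.exp s) := by
      refine lt_of_lt_of_le ?_ (Finset.single_le_sum (f := fun j => ((n + 1).choose j : ℝ) *
        (ε * Real.exp s) ^ (n + 1 - j) * b j) (fun j _ => mul_nonneg (by positivity) (hb j))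
        (Finset.mem_range.2 (Nat.succ_pos _)))
      have h0 : 0 < b 0 := by simpa [binomialSum] using hpos 0
      simpa using mul_pos (pow_pos ht (n + 1)) h0
    have h2 := Real.log_le_log hb2 (hup (n + 1))
    rw [Real.log_mul hC.ne' (by positivity), Real.log_pow] at h2
    have h3 := hlow (n + 1)
    push_cast at h2 h3
    have hn1 : (0 : ℝ) < n + 1 := by positivity
    have h4 : ((n : ℝ) + 1) * (q n * s) ≤ (n + 1) * ((Real.log C - Real.log c) *
        (1 / ((n : ℝ) + 1)) + Real.log (R + ε * Real.exp s - ε) - l (n + 1)) := by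
      have h5 : ((n : ℝ) + 1) * ((Real.log C - Real.log c) * (1 / ((n : ℝ) + 1)) +
          Real.log (R + ε * Real.exp s - ε) - l (n + 1)) = Real.log C - Real.log c +
          (n + 1) * Real.log (R + ε * Real.exp s - ε) - (n + 1) * l (n + 1) := by
        field_simp
      rw [h5]
      simp only [hqdef]
      linarith
    have h6 := le_of_mul_le_mul_left h4 hn1
    simp only [Real.exp_zero, mul_one, add_sub_cancel_right]
    linarith
  have h7 : Tendsto (fun n => ε / q n) atTop (𝓝 (ε / (ε / R))) :=
    tendsto_const_nhds.div hq (by positivity)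
  rw [div_div_cancel₀ hε.ne'] at h7
  refine h7.congr fun n => ?_
  simp only [hqdef]
  have := (hpos n).ne'
  have := (hpos (n + 1)).ne'
  field_simp

end RandomWalk

/-! ### Growth and ratio limits in the monoid algebra -/

namespace RandomWalk

open scoped NNReal

variable {G : Type*} [Group G]

/-- Coefficientwise domination in the monoid algebra over `ℝ≥0`. -/
def DominatedBy (f h : MonoidAlgebra ℝ≥0 G) : Prop := ∃ d, h = f + d

namespace DominatedBy

theorem refl (f : MonoidAlgebra ℝ≥0 G) : DominatedBy f f := ⟨0, (add_zero f).symm⟩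

theorem trans {f g h : MonoidAlgebra ℝ≥0 G} (hfg : DominatedBy f g) (hgh : DominatedBy g h) :
    DominatedBy f h := by
  obtain ⟨d, rfl⟩ := hfg
  obtain ⟨e, rfl⟩ := hgh
  exact ⟨d + e, add_assoc _ _ _⟩

theorem mul {f f' g g' : MonoidAlgebra ℝ≥0 G} (hf : DominatedBy f f') (hg : DominatedBy g g') :
    DominatedBy (f * g) (f' * g') := by
  obtain ⟨d, rfl⟩ := hf
  obtain ⟨e, rfl⟩ := hg
  exact ⟨f * e + (d * g + d * e), by rw [add_mul, mul_add, mul_add, add_assoc]⟩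

theorem pow {f g : MonoidAlgebra ℝ≥0 G} (h : DominatedBy f g) (n : ℕ) :
    DominatedBy (f ^ n) (g ^ n) := by
  induction n with
  | zero => simpa using refl _
  | succ n ih => simpa only [pow_succ] using ih.mul h

theorem smul {f g : MonoidAlgebra ℝ≥0 G} (h : DominatedBy f g) (c : ℝ≥0) :
    DominatedBy (c • f) (c • g) := by
  obtain ⟨d, rfl⟩ := h
  exact ⟨c • d, smul_add _ _ _⟩

theorem coeff_le {f g : MonoidAlgebra ℝ≥0 G} (h : DominatedBy f g) (x : G) :
    f.coeff x ≤ g.coeff x := by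
  obtain ⟨d, rfl⟩ := h
  simp

theorem single_coeff (f : MonoidAlgebra ℝ≥0 G) (x : G) :
    DominatedBy (MonoidAlgebra.single x (f.coeff x)) f :=
  ⟨f.erase x, (MonoidAlgebra.single_add_erase x f).symm⟩

end DominatedBy

theorem coeff_mul_coeff_le (f g : MonoidAlgebra ℝ≥0 G) (x y : G) :
    f.coeff x * g.coeff y ≤ (f * g).coeff (x * y) := by
  have h := ((DominatedBy.single_coeff f x).mul (DominatedBy.single_coeff g y)).coeff_le (x * y)
  simpa [MonoidAlgebra.single_mul_single] using h

theorem coeff_one_mul_coeff_one_le (f g : MonoidAlgebra ℝ≥0 G) :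
    f.coeff 1 * g.coeff 1 ≤ (f * g).coeff 1 := by
  simpa using coeff_mul_coeff_le f g 1 1

theorem coeff_one_pow_le (f : MonoidAlgebra ℝ≥0 G) (n : ℕ) :
    f.coeff 1 ^ n ≤ (f ^ n).coeff 1 := by
  induction n with
  | zero => simp
  | succ n ih =>
    rw [pow_succ, pow_succ]
    exact (mul_le_mul_left ih _).trans (coeff_one_mul_coeff_one_le _ _)

/-- The augmentation (total mass) is multiplicative and bounds each coefficient. -/
theorem exists_coeff_pow_le (f : MonoidAlgebra ℝ≥0 G) (x : G) :
    ∃ M : ℝ≥0, ∀ n, (f ^ n).coeff x ≤ M ^ n := by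
  let aug : MonoidAlgebra ℝ≥0 G →ₐ[ℝ≥0] ℝ≥0 := MonoidAlgebra.lift ℝ≥0 ℝ≥0 G 1
  have key : ∀ g : MonoidAlgebra ℝ≥0 G, g.coeff x ≤ aug g := fun g => by
    have h : aug (MonoidAlgebra.single x (g.coeff x)) = g.coeff x := by simp [aug]
    obtain ⟨d, hd⟩ := DominatedBy.single_coeff g x
    calc g.coeff x ≤ aug (MonoidAlgebra.single x (g.coeff x)) + aug d := by
          rw [h]; exact le_self_add
      _ = aug g := by rw [← map_add, ← hd]
  exact ⟨aug f, fun n => (key _).trans_eq (map_pow _ _ _)⟩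

/-- The return coefficients of the powers of an element with positive coefficient at `1` have an
exponential growth rate, which bounds them. -/
theorem exists_growth_rate (f : MonoidAlgebra ℝ≥0 G) (hf : 0 < f.coeff 1) :
    ∃ R : ℝ, 0 < R ∧ (∀ n, ((f ^ n).coeff 1 : ℝ) ≤ R ^ n) ∧
      Tendsto (fun n : ℕ => Real.log ((f ^ n).coeff 1) / n) atTop (𝓝 (Real.log R)) := by
  have hpos : ∀ n, (0 : ℝ) < (f ^ n).coeff 1 := fun n =>
    NNReal.coe_pos.2 ((pow_pos hf n).trans_le (coeff_one_pow_le f n))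
  -- Fekete's lemma: the limit is an infimum, so `R ^ n` is a bound without a constant.
  have hsub : Subadditive fun n => -Real.log ((f ^ n).coeff 1) := fun m n => by
    rw [← neg_add, ← Real.log_mul (hpos m).ne' (hpos n).ne', neg_le_neg_iff]
    refine Real.log_le_log (mul_pos (hpos m) (hpos n)) ?_
    rw [pow_add]
    exact_mod_cast coeff_one_mul_coeff_one_le (f ^ m) (f ^ n)
  obtain ⟨M, hM⟩ := exists_coeff_pow_le f 1
  have hbdd : BddBelow (Set.range fun n : ℕ => -Real.log ((f ^ n).coeff 1) / n) := by
    refine ⟨min 0 (-Real.log M), ?_⟩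
    rintro _ ⟨n, rfl⟩
    rcases Nat.eq_zero_or_pos n with rfl | hn
    · simp
    · refine (min_le_right _ _).trans ?_
      have hn' : (0 : ℝ) < n := Nat.cast_pos.2 hn
      have h1 : ((f ^ n).coeff 1 : ℝ) ≤ (M : ℝ) ^ n := by exact_mod_cast hM n
      have h2 := Real.log_le_log (hpos n) h1
      rw [Real.log_pow] at h2
      change _ ≤ -Real.log ((f ^ n).coeff 1) / n
      rw [le_div_iff₀ hn']
      linarith
  refine ⟨Real.exp (-hsub.lim), Real.exp_pos _, fun n => ?_, ?_⟩
  · rcases Nat.eq_zero_or_pos n with rfl | hn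
    · simp
    · have h := hsub.lim_le_div hbdd hn.ne'
      have hn' : (0 : ℝ) < n := Nat.cast_pos.2 hn
      rw [le_div_iff₀ hn'] at h
      rw [← Real.exp_nat_mul, ← Real.log_le_iff_le_exp (hpos n)]
      linarith
  · rw [Real.log_exp]
    refine (hsub.tendsto_lim hbdd).neg.congr fun n => ?_
    rw [neg_div, neg_neg]

theorem coeff_add_smul_one_pow_mul (σ τ : MonoidAlgebra ℝ≥0 G) (t : ℝ≥0) (n : ℕ) :
    ((((σ + t • (1 : MonoidAlgebra ℝ≥0 G)) ^ n * τ).coeff 1 : ℝ≥0) : ℝ) =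
      binomialSum (fun j => ((σ ^ j * τ).coeff 1 : ℝ)) n t := by
  have hcomm : Commute σ (t • (1 : MonoidAlgebra ℝ≥0 G)) := (Commute.one_right σ).smul_right t
  have h : (σ + t • (1 : MonoidAlgebra ℝ≥0 G)) ^ n * τ =
      ∑ j ∈ Finset.range (n + 1), ((n.choose j : ℝ≥0) * t ^ (n - j)) • (σ ^ j * τ) := by
    rw [hcomm.add_pow, Finset.sum_mul]
    refine Finset.sum_congr rfl fun j _ => ?_
    rw [smul_pow, one_pow, mul_smul_comm, mul_one, ← nsmul_eq_mul', smul_mul_assoc,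
      smul_mul_assoc, ← Nat.cast_smul_eq_nsmul ℝ≥0, smul_smul]
  rw [h, binomialSum, MonoidAlgebra.coeff_sum, Finset.sum_apply', NNReal.coe_sum]
  exact Finset.sum_congr rfl fun j _ => by simp

theorem le_of_forall_mul_pow_le {c y R : ℝ} (hc : 0 < c) (hR : 0 < R)
    (h : ∀ n : ℕ, c * y ^ n ≤ R ^ n) : y ≤ R := by
  by_contra! hlt
  have h1 : 1 < y / R := (one_lt_div hR).2 hlt
  obtain ⟨n, hn⟩ := pow_unbounded_of_one_lt (1 / c) h1
  have h2 := h n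
  rw [div_pow, div_lt_div_iff₀ hc (pow_pos hR n)] at hn
  linarith

/-- Changing the coefficient at `1` by `t - ε` changes the growth rate by `t - ε`. -/
theorem coeff_add_smul_one_pow_le (σ : MonoidAlgebra ℝ≥0 G) {ε t : ℝ≥0} (ht : 0 < t)
    {R : ℝ} (hR0 : 0 < R)
    (hR : ∀ n, ((((σ + ε • (1 : MonoidAlgebra ℝ≥0 G)) ^ n).coeff 1 : ℝ≥0) : ℝ) ≤ R ^ n) (N : ℕ) :
    ((((σ + t • (1 : MonoidAlgebra ℝ≥0 G)) ^ N).coeff 1 : ℝ≥0) : ℝ) ≤ (R + t - ε) ^ N := by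
  have shift : ∀ a b : ℝ≥0, a ≤ b → ∀ n,
      ((((σ + b • (1 : MonoidAlgebra ℝ≥0 G)) ^ n).coeff 1 : ℝ≥0) : ℝ) =
      ∑ j ∈ Finset.range (n + 1), (n.choose j : ℝ) * ((b : ℝ) - a) ^ (n - j) *
        ((((σ + a • (1 : MonoidAlgebra ℝ≥0 G)) ^ j).coeff 1 : ℝ≥0) : ℝ) := by
    intro a b hab n
    have h := coeff_add_smul_one_pow_mul (σ + a • (1 : MonoidAlgebra ℝ≥0 G)) 1 (b - a) n
    rw [add_assoc, ← add_smul, add_tsub_cancel_of_le hab] at h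
    simpa only [mul_one, binomialSum, NNReal.coe_sub hab] using h
  have binom : ∀ (x y : ℝ) (n : ℕ), (x + y) ^ n =
      ∑ j ∈ Finset.range (n + 1), (n.choose j : ℝ) * y ^ (n - j) * x ^ j := fun x y n => by
    rw [add_pow]
    exact Finset.sum_congr rfl fun j _ => by ring
  rcases le_total ε t with hεt | hεt
  · rw [shift ε t hεt, add_sub_assoc, binom]
    have hεt' : (0 : ℝ) ≤ t - ε := sub_nonneg.2 hεt
    exact Finset.sum_le_sum fun j _ => mul_le_mul_of_nonneg_left (hR j) (by positivity)
  · rcases Nat.eq_zero_or_pos N with rfl | hN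
    · simp
    set g := σ + t • (1 : MonoidAlgebra ℝ≥0 G) with hg
    have ht' : (0 : ℝ) < t := ht
    have hεt' : (0 : ℝ) ≤ ε - t := sub_nonneg.2 hεt
    have hg1 : t ≤ g.coeff 1 := by simp [hg]
    have htN : ∀ n, (t : ℝ) ^ n ≤ (g ^ n).coeff 1 := fun n => by
      exact_mod_cast (pow_le_pow_left₀ t.2 hg1 n).trans (coeff_one_pow_le g n)
    have hAN : (0 : ℝ) < (g ^ N).coeff 1 := (pow_pos ht' N).trans_le (htN N)
    -- When `t ≤ ε`, expand towards `ε`: powers of `g` grow at least like `x ^ j` up to a constant,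
    -- so `g + (ε - t) • 1` grows at least like `(x + ε - t) ^ n`, whence `x + ε - t ≤ R`.
    set x : ℝ := ((g ^ N).coeff 1 : ℝ) ^ ((N : ℝ)⁻¹) with hx
    have hx0 : 0 < x := Real.rpow_pos_of_pos hAN _
    have hxN : x ^ N = (g ^ N).coeff 1 := Real.rpow_inv_natCast_pow hAN.le hN.ne'
    have htx : t ≤ x := by
      rw [← pow_le_pow_iff_left₀ ht'.le hx0.le hN.ne', hxN]
      exact htN N
    -- Divide `j` by `N`; the remainder, shorter than `N`, costs at most the factor `(t / x) ^ N`.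
    have hlow : ∀ j, (t / x) ^ N * x ^ j ≤ (g ^ j).coeff 1 := fun j => by
      have h1 : (((g ^ N).coeff 1 : ℝ)) ^ (j / N) * (t : ℝ) ^ (j % N) ≤ (g ^ j).coeff 1 := by
        have h2 : (g ^ N).coeff 1 ^ (j / N) * (g ^ (j % N)).coeff 1 ≤ (g ^ j).coeff 1 := by
          calc _ ≤ ((g ^ N) ^ (j / N)).coeff 1 * (g ^ (j % N)).coeff 1 :=
                mul_le_mul_left (coeff_one_pow_le _ _) _
            _ ≤ ((g ^ N) ^ (j / N) * g ^ (j % N)).coeff 1 := coeff_one_mul_coeff_one_le _ _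
            _ = (g ^ j).coeff 1 := by rw [← pow_mul, ← pow_add, Nat.div_add_mod]
        refine le_trans ?_ (NNReal.coe_le_coe.2 h2)
        push_cast
        exact mul_le_mul_of_nonneg_left (htN _) (by positivity)
      refine le_trans ?_ h1
      rw [← hxN, ← pow_mul]
      have h3 : (t / x) ^ N ≤ (t / x) ^ (j % N) :=
        pow_le_pow_of_le_one (by positivity) ((div_le_one hx0).2 htx) (Nat.mod_lt _ hN).le
      calc (t / x) ^ N * x ^ j ≤ (t / x) ^ (j % N) * x ^ j :=
            mul_le_mul_of_nonneg_right h3 (by positivity)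
        _ = x ^ (N * (j / N)) * (t : ℝ) ^ (j % N) := by
            conv_lhs => rw [← Nat.div_add_mod j N, pow_add]
            rw [Nat.mul_add_mod, Nat.mod_mod, div_pow]
            field_simp
    have hxR : x + (ε - t) ≤ R := by
      refine le_of_forall_mul_pow_le (c := (t / x) ^ N) (by positivity) hR0 fun n => ?_
      refine le_trans ?_ (hR n)
      rw [shift t ε hεt, binom, Finset.mul_sum]
      refine Finset.sum_le_sum fun j _ => ?_
      have := mul_le_mul_of_nonneg_left (hlow j)
        (show (0 : ℝ) ≤ (n.choose j : ℝ) * ((ε : ℝ) - t) ^ (n - j) by positivity)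
      linarith
    rw [← hxN]
    exact pow_le_pow_left₀ hx0.le (by linarith) N

/-- Ratio limit theorem for a lazy element `σ + ε • 1`, twisted by an element `τ` dominated by
a multiple of one of its powers. -/
theorem tendsto_lazy_ratio (σ τ : MonoidAlgebra ℝ≥0 G) {ε c : ℝ≥0} (hε : 0 < ε) (hc : 0 < c)
    {R : ℝ} (hR0 : 0 < R)
    (hR : ∀ n, ((((σ + ε • (1 : MonoidAlgebra ℝ≥0 G)) ^ n).coeff 1 : ℝ≥0) : ℝ) ≤ R ^ n)
    (hlim : Tendsto (fun n : ℕ =>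
      Real.log (((σ + ε • (1 : MonoidAlgebra ℝ≥0 G)) ^ n).coeff 1) / n) atTop (𝓝 (Real.log R)))
    (hτ : 0 < τ.coeff 1) {m : ℕ}
    (hdom : DominatedBy (c • τ) ((σ + ε • (1 : MonoidAlgebra ℝ≥0 G)) ^ m)) :
    Tendsto (fun n => (((σ + ε • (1 : MonoidAlgebra ℝ≥0 G)) ^ (n + 1) * τ).coeff 1 : ℝ) /
      (((σ + ε • (1 : MonoidAlgebra ℝ≥0 G)) ^ n * τ).coeff 1 : ℝ)) atTop (𝓝 R) := by
  set f := σ + ε • (1 : MonoidAlgebra ℝ≥0 G) with hf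
  have hf1 : ε ≤ f.coeff 1 := by simp [hf]
  have hfpos : ∀ n, (0 : ℝ) < (f ^ n).coeff 1 := fun n => NNReal.coe_pos.2
    ((pow_pos (hε.trans_le hf1) n).trans_le (coeff_one_pow_le f n))
  have hfτ : ∀ n, ((f ^ n).coeff 1 : ℝ) * τ.coeff 1 ≤ (f ^ n * τ).coeff 1 := fun n => by
    exact_mod_cast coeff_one_mul_coeff_one_le (f ^ n) τ
  have hτ' : (0 : ℝ) < τ.coeff 1 := hτ
  simp_rw [hf, coeff_add_smul_one_pow_mul]
  refine tendsto_binomialSum_ratio (fun j => NNReal.coe_nonneg _) hε ?_ (fun n => ?_)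
    (fun t ht => ?_) ⟨τ.coeff 1, hτ', fun n : ℕ => Real.log ((f ^ n).coeff 1) / n, hlim,
      fun n => ?_⟩
  · refine le_trans (NNReal.coe_le_coe.2 hf1) ?_
    simpa using hR 1
  · rw [← coeff_add_smul_one_pow_mul, ← hf]
    exact (mul_pos (hfpos n) hτ').trans_le (hfτ n)
  · lift t to ℝ≥0 using ht.le
    have ht0 : 0 < t := ht
    -- Chosen so that `k • f` is dominated by `σ + t • 1`; this carries the domination of `τ` from
    -- `ε` to `t`.
    set k := min 1 (t / ε) with hk
    have hk0 : 0 < k := lt_min one_pos (div_pos ht0 hε)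
    have hkf : DominatedBy (k • f) (σ + t • (1 : MonoidAlgebra ℝ≥0 G)) := by
      refine ⟨(1 - k) • σ + (t - k * ε) • (1 : MonoidAlgebra ℝ≥0 G), ?_⟩
      have h1 : k + (1 - k) = 1 := add_tsub_cancel_of_le (min_le_left _ _)
      have h2 : k * ε + (t - k * ε) = t := add_tsub_cancel_of_le
        ((le_div_iff₀ hε).1 (min_le_right _ _))
      calc _ = (k + (1 - k)) • σ + (k * ε + (t - k * ε)) • (1 : MonoidAlgebra ℝ≥0 G) := by
            rw [h1, h2, one_smul]
        _ = _ := by rw [hf, smul_add, smul_smul, add_smul, add_smul]; abel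
    have h3 : DominatedBy ((k ^ m * c) • τ) ((σ + t • (1 : MonoidAlgebra ℝ≥0 G)) ^ m) := by
      have h4 := hkf.pow m
      rw [smul_pow] at h4
      have h5 := hdom.smul (k ^ m)
      rw [smul_smul] at h5
      exact h5.trans h4
    have hRt : 0 < R + t - ε := by
      have : (ε : ℝ) ≤ R := (NNReal.coe_le_coe.2 hf1).trans (by simpa using hR 1)
      linarith
    have hC : (0 : ℝ) < (k ^ m * c : ℝ≥0) := NNReal.coe_pos.2 (mul_pos (pow_pos hk0 m) hc)
    refine ⟨((k ^ m * c : ℝ≥0) : ℝ)⁻¹ * (R + t - ε) ^ m, by positivity, fun n => ?_⟩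
    rw [← coeff_add_smul_one_pow_mul]
    have h6 := ((DominatedBy.refl ((σ + t • (1 : MonoidAlgebra ℝ≥0 G)) ^ n)).mul h3).coeff_le 1
    rw [← pow_add, mul_smul_comm, MonoidAlgebra.coeff_smul_apply, smul_eq_mul] at h6
    have h7 := (NNReal.coe_le_coe.2 h6).trans
      (coeff_add_smul_one_pow_le σ ht0 hR0 hR (n + m))
    rw [NNReal.coe_mul, pow_add, mul_comm ((R + t - ε) ^ n)] at h7
    rw [mul_assoc, le_inv_mul_iff₀ hC]
    exact h7
  · rw [← coeff_add_smul_one_pow_mul, ← hf]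
    refine le_trans (le_of_eq ?_) (Real.log_le_log (mul_pos (hfpos n) hτ') (hfτ n))
    rw [Real.log_mul (hfpos n).ne' hτ'.ne', add_comm]
    congr 1
    rcases Nat.eq_zero_or_pos n with rfl | hn
    · simp
    · exact mul_div_cancel₀ _ (Nat.cast_pos.2 hn).ne'

theorem tendsto_of_tendsto_residues {X : Type*} {l : Filter X} {u : ℕ → X} {k N : ℕ}
    (hk : 0 < k)
    (h : ∀ i < k, Tendsto (fun n => u (k * n + (N + i))) atTop l) : Tendsto u atTop l := by
  rw [← tendsto_add_atTop_iff_nat N]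
  intro U hU
  have h1 : ∀ᶠ n in atTop, ∀ i ∈ Finset.range k, u (k * n + (N + i)) ∈ U :=
    (Finset.eventually_all _).2 fun i hi => h i (Finset.mem_range.1 hi) hU
  have h2 := (Nat.tendsto_div_const_atTop hk.ne').eventually h1
  rw [mem_map]
  filter_upwards [h2] with n hn
  have h3 := hn (n % k) (Finset.mem_range.2 (Nat.mod_lt n hk))
  have h4 : k * (n / k) + (N + n % k) = n + N := by
    have := Nat.div_add_mod n k
    omega
  rwa [h4] at h3

/-- Right translation by `x⁻¹` moves the coefficient at `x` to `1`, and the factor `p ^ r` selects a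
residue class. `R` depends only on `p ^ k`, so it serves all `x` and `r`. -/
theorem exists_tendsto_coeff_add_div (p : MonoidAlgebra ℝ≥0 G)
    (hp : ∀ x, ∀ᶠ n in atTop, 0 < (p ^ n).coeff x) {k : ℕ} (hk : 0 < k)
    (hpk : 0 < (p ^ k).coeff 1) :
    ∃ R : ℝ, 0 < R ∧ ∀ x, Tendsto (fun n => ((p ^ (n + k)).coeff x : ℝ) / (p ^ n).coeff x)
      atTop (𝓝 R) := by
  obtain ⟨R, hR0, hR, hlim⟩ := exists_growth_rate (p ^ k) hpk
  refine ⟨R, hR0, fun x => ?_⟩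
  obtain ⟨N, hN⟩ := eventually_atTop.1 (hp x)
  obtain ⟨N', hN'⟩ := eventually_atTop.1 (hp x⁻¹)
  refine tendsto_of_tendsto_residues (N := N) hk fun i _ => ?_
  generalize hr : N + i = r
  set ε := (p ^ k).coeff 1 with hε
  obtain ⟨σ, hσ⟩ : ∃ σ, p ^ k = σ + ε • (1 : MonoidAlgebra ℝ≥0 G) := by
    refine ⟨(p ^ k).erase 1, ?_⟩
    rw [MonoidAlgebra.one_def, MonoidAlgebra.smul_single', mul_one, add_comm, hε,
      MonoidAlgebra.single_add_erase]
  set M := N' + r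
  set s := k * M - r with hs
  have hkM : M ≤ k * M := Nat.le_mul_of_pos_left M hk
  have hrs : r + s = k * M := by omega
  have hcoeff : ∀ n, (((p ^ k) ^ n * (p ^ r * MonoidAlgebra.single x⁻¹ 1)).coeff 1) =
      (p ^ (k * n + r)).coeff x := fun n => by
    rw [← mul_assoc, MonoidAlgebra.coeff_mul_single_apply, inv_inv, one_mul, mul_one,
      ← pow_mul, ← pow_add]
  have hdom : DominatedBy ((p ^ s).coeff x⁻¹ • (p ^ r * MonoidAlgebra.single x⁻¹ 1))
      ((p ^ k) ^ M) := by
    rw [← mul_smul_comm, MonoidAlgebra.smul_single', mul_one, ← pow_mul, ← hrs, pow_add]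
    exact (DominatedBy.refl (p ^ r)).mul (DominatedBy.single_coeff (p ^ s) x⁻¹)
  have hτ : 0 < (p ^ r * MonoidAlgebra.single x⁻¹ 1).coeff 1 := by
    have := hcoeff 0
    rw [pow_zero, one_mul, mul_zero, zero_add] at this
    rw [this]
    exact hN r (by omega)
  rw [hσ] at hR hlim hdom
  have h := tendsto_lazy_ratio σ _ hpk (hN' s (by omega)) hR0 hR hlim hτ hdom
  rw [← hσ] at h
  simp_rw [hcoeff] at h
  refine h.congr fun n => ?_
  rw [show k * (n + 1) + r = k * n + r + k by ring]

/-- The strong ratio limit property of the powers of an element of the monoid algebra. -/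
theorem exists_tendsto_coeff_succ_div (p : MonoidAlgebra ℝ≥0 G)
    (hp : ∀ x, ∀ᶠ n in atTop, 0 < (p ^ n).coeff x) :
    ∃ L : ℝ, 0 < L ∧ ∀ x, Tendsto (fun n => ((p ^ (n + 1)).coeff x : ℝ) / (p ^ n).coeff x)
      atTop (𝓝 L) := by
  obtain ⟨K, hK⟩ := eventually_atTop.1 (hp 1)
  -- The steps `K + 1` and `K + 2` differ by one; the quotient of their limits is the one-step
  -- limit.
  obtain ⟨R, hR0, hR⟩ := exists_tendsto_coeff_add_div p hp (Nat.succ_pos K) (hK _ (by omega))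
  obtain ⟨S, hS0, hS⟩ :=
    exists_tendsto_coeff_add_div p hp (Nat.succ_pos (K + 1)) (hK _ (by omega))
  refine ⟨S / R, div_pos hS0 hR0, fun x => ?_⟩
  have h := (hS x).div ((hR x).comp (tendsto_add_atTop_nat 1)) hR0.ne'
  refine h.congr' ?_
  obtain ⟨N, hN⟩ := eventually_atTop.1 (hp x)
  filter_upwards [eventually_ge_atTop N] with n hn
  have h1 : ((p ^ n).coeff x : ℝ) ≠ 0 := by exact_mod_cast (hN n hn).ne'
  have h2 : ((p ^ (n + 1)).coeff x : ℝ) ≠ 0 := by exact_mod_cast (hN (n + 1) (by omega)).ne'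
  have h3 : ((p ^ (n + (K + 1).succ)).coeff x : ℝ) ≠ 0 := by
    exact_mod_cast (hN _ (by omega)).ne'
  have h4 : n + 1 + K.succ = n + (K + 1).succ := by omega
  change ((p ^ (n + (K + 1).succ)).coeff x : ℝ) / (p ^ n).coeff x /
    (((p ^ (n + 1 + K.succ)).coeff x : ℝ) / (p ^ (n + 1)).coeff x) = _
  rw [h4]
  field_simp

end RandomWalk

/-! ### From measures to the monoid algebra -/

namespace RandomWalk

open scoped NNReal

theorem mconv_singleton {Γ : Type*} [Group Γ] [Countable Γ] [MeasurableSpace Γ]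
    [DiscreteMeasurableSpace Γ] (μ ν : Measure Γ) [SFinite ν] (hfin : (supp μ).Finite) (x : Γ) :
    (μ ∗ₘ ν) {x} = ∑ y ∈ hfin.toFinset, μ {y} * ν {y⁻¹ * x} := by
  have hpre : ∀ y : Γ, (Prod.mk y ⁻¹' ((fun z : Γ × Γ => z.1 * z.2) ⁻¹' {x})) = {y⁻¹ * x} := by
    intro y
    ext z
    simp [eq_inv_mul_iff_mul_eq]
  rw [Measure.mconv, Measure.map_apply .of_discrete (.of_discrete),
    Measure.prod_apply .of_discrete, lintegral_countable']
  simp_rw [hpre]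
  rw [tsum_eq_sum (s := hfin.toFinset)]
  · exact Finset.sum_congr rfl fun y _ => mul_comm _ _
  · intro y hy
    have : μ {y} = 0 := by simpa [supp] using hy
    rw [this, mul_zero]

/-- A finitely supported measure as an element of the monoid algebra. -/
noncomputable def toMonoidAlgebra {Γ : Type*} [Group Γ] [MeasurableSpace Γ] (μ : Measure Γ)
    (hfin : (supp μ).Finite) : MonoidAlgebra ℝ≥0 Γ :=
  .ofCoeff (Finsupp.onFinset hfin.toFinset (fun x => (μ {x}).toNNReal) fun x hx => by
    rw [Set.Finite.mem_toFinset, supp, Set.mem_ofPred_eq, pos_iff_ne_zero]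
    rintro h
    simp [h] at hx)

theorem coe_coeff_toMonoidAlgebra {Γ : Type*} [Group Γ] [MeasurableSpace Γ] (μ : Measure Γ)
    [IsProbabilityMeasure μ] (hfin : (supp μ).Finite) (x : Γ) :
    ((toMonoidAlgebra μ hfin).coeff x : ℝ≥0∞) = μ {x} :=
  ENNReal.coe_toNNReal (measure_ne_top μ _)

section

variable {Γ : Type*} [Group Γ] [MeasurableSpace Γ] (μ : Measure Γ) [IsProbabilityMeasure μ]
  (hfin : (supp μ).Finite)

theorem coeff_toMonoidAlgebra_mul (f : MonoidAlgebra ℝ≥0 Γ) (x : Γ) :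
    ((toMonoidAlgebra μ hfin * f).coeff x : ℝ≥0∞) =
      ∑ y ∈ hfin.toFinset, μ {y} * f.coeff (y⁻¹ * x) := by
  rw [MonoidAlgebra.coeff_mul_apply_left, Finsupp.sum_of_support_subset (s := hfin.toFinset)]
  · push_cast
    exact Finset.sum_congr rfl fun y _ => by rw [coe_coeff_toMonoidAlgebra]
  · intro y hy
    rw [Finsupp.mem_support_iff, ← ENNReal.coe_ne_zero, coe_coeff_toMonoidAlgebra] at hy
    simpa [supp, pos_iff_ne_zero] using hy
  · simp

instance sFinite_convPow [Countable Γ] [DiscreteMeasurableSpace Γ] (n : ℕ) : SFinite (convPow μ n) := by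
  induction n with
  | zero => exact inferInstanceAs (SFinite (Measure.dirac 1))
  | succ n ih => exact inferInstanceAs (SFinite (μ ∗ₘ convPow μ n))

theorem convPow_singleton [Countable Γ] [DiscreteMeasurableSpace Γ] (n : ℕ) (x : Γ) :
    convPow μ n {x} = ((toMonoidAlgebra μ hfin ^ n).coeff x : ℝ≥0∞) := by
  classical
  induction n generalizing x with
  | zero =>
    rw [convPow, pow_zero, MonoidAlgebra.one_def, MonoidAlgebra.coeff_single,
      Finsupp.single_apply, Measure.dirac_apply' _ (.of_discrete), Set.indicator_apply]
    simp only [Set.mem_singleton_iff, Pi.one_apply]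
    split_ifs <;> simp
  | succ n ih =>
    rw [convPow, mconv_singleton _ _ hfin, pow_succ', coeff_toMonoidAlgebra_mul]
    exact Finset.sum_congr rfl fun y _ => by rw [ih]

theorem coeff_pos_of_mem_supp_pow {n : ℕ} {x : Γ} (hx : x ∈ supp μ ^ n) :
    0 < (toMonoidAlgebra μ hfin ^ n).coeff x := by
  induction n generalizing x with
  | zero =>
    rw [pow_zero, Set.mem_one] at hx
    simp [hx]
  | succ n ih =>
    rw [pow_succ] at hx
    obtain ⟨y, hy, z, hz, rfl⟩ := Set.mem_mul.1 hx
    have hz' : 0 < (toMonoidAlgebra μ hfin).coeff z := by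
      rw [← ENNReal.coe_pos, coe_coeff_toMonoidAlgebra]
      exact hz
    rw [pow_succ]
    exact (mul_pos (ih hy) hz').trans_le (coeff_mul_coeff_le _ _ _ _)

theorem eventually_coeff_pow_pos [Countable Γ] [DiscreteMeasurableSpace Γ]
    (hirr : IsIrreducible μ) (haper : period μ = 1) (x : Γ) :
    ∀ᶠ n in atTop, 0 < (toMonoidAlgebra μ hfin ^ n).coeff x := by
  set p := toMonoidAlgebra μ hfin with hp
  let S : AddSubmonoid ℕ :=
    { carrier := {n | 0 < (p ^ n).coeff 1}
      zero_mem' := by simp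
      add_mem' := fun {a b} ha hb => by
        change 0 < (p ^ (a + b)).coeff 1
        rw [pow_add]
        exact (mul_pos ha hb).trans_le (coeff_one_mul_coeff_one_le _ _) }
  have hS : AddSubmonoid.closure {n : ℕ | 1 ≤ n ∧ 0 < convPow μ n {1}} ≤ S := by
    rw [AddSubmonoid.closure_le]
    rintro n ⟨-, hn⟩
    rwa [convPow_singleton μ hfin, ENNReal.coe_pos] at hn
  obtain ⟨N, hN⟩ := Nat.exists_mem_closure_of_ge {n : ℕ | 1 ≤ n ∧ 0 < convPow μ n {1}}
  have hx : x ∈ ⋃ n : ℕ, ⋃ _ : 1 ≤ n, supp μ ^ n := by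
    rw [IsIrreducible] at hirr
    rw [hirr]
    exact Set.mem_univ x
  simp only [Set.mem_iUnion] at hx
  obtain ⟨j, -, hj⟩ := hx
  have hj' := coeff_pos_of_mem_supp_pow μ hfin hj
  filter_upwards [eventually_ge_atTop (N + j)] with n hn
  have h1 : 0 < (p ^ (n - j)).coeff 1 := hS (hN (n - j) (by omega)
    (by rw [period] at haper; rw [haper]; exact one_dvd _))
  have h2 := coeff_mul_coeff_le (p ^ (n - j)) (p ^ j) 1 x
  rw [one_mul, ← pow_add, Nat.sub_add_cancel (by omega)] at h2
  exact (mul_pos h1 hj').trans_le h2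

end

/-! ### Spectral radius and subsequential limits -/

theorem tendsto_log_div_of_tendsto_ratio {a : ℕ → ℝ} (h0 : a 0 = 1)
    (ha : ∀ᶠ n in atTop, 0 < a n) {L : ℝ} (hL : 0 < L)
    (h : Tendsto (fun n => a (n + 1) / a n) atTop (𝓝 L)) :
    Tendsto (fun n : ℕ => Real.log (a n) / n) atTop (𝓝 (Real.log L)) := by
  have h1 : Tendsto (fun n => Real.log (a (n + 1)) - Real.log (a n)) atTop (𝓝 (Real.log L)) := by
    refine ((Real.continuousAt_log hL.ne').tendsto.comp h).congr' ?_
    filter_upwards [ha, (tendsto_add_atTop_nat 1).eventually ha] with n h2 h3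
    exact Real.log_div h3.ne' h2.ne'
  refine h1.cesaro.congr fun n => ?_
  rw [Finset.sum_range_sub (fun i => Real.log (a i)), h0, Real.log_one, sub_zero,
    div_eq_inv_mul]

theorem limsup_rpow_one_div_of_tendsto_ratio {a : ℕ → ℝ≥0} (h0 : a 0 = 1)
    (ha : ∀ᶠ n in atTop, 0 < a n) {L : ℝ} (hL : 0 < L)
    (h : Tendsto (fun n => (a (n + 1) : ℝ) / a n) atTop (𝓝 L)) :
    limsup (fun n : ℕ => (a n : ℝ≥0∞) ^ (1 / (n : ℝ))) atTop = ENNReal.ofReal L := by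
  refine Tendsto.limsup_eq ?_
  have h1 := tendsto_log_div_of_tendsto_ratio (a := fun n => (a n : ℝ)) (by simp [h0])
    (by simpa using ha) hL h
  have h2 := ENNReal.tendsto_ofReal ((Real.continuous_exp.tendsto _).comp h1)
  rw [Real.exp_log hL] at h2
  refine h2.congr' ?_
  filter_upwards [ha] with n hn
  have hn' : (0 : ℝ) < a n := hn
  rw [← ENNReal.ofReal_coe_nnreal, ENNReal.ofReal_rpow_of_pos hn', Real.rpow_def_of_pos hn',
    mul_one_div]
  rfl

theorem ofReal_coe_div {a b : ℝ≥0} (hb : 0 < b) :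
    ENNReal.ofReal ((a : ℝ) / b) = (a : ℝ≥0∞) / b := by
  rw [ENNReal.ofReal_div_of_pos (NNReal.coe_pos.2 hb), ENNReal.ofReal_coe_nnreal, ENNReal.ofReal_coe_nnreal]

/-- Harnack inequality: the normalized powers are bounded at every point. -/
theorem exists_eventually_coeff_div_le {G : Type*} [Group G] (p : MonoidAlgebra ℝ≥0 G)
    (hp : ∀ x, ∀ᶠ n in atTop, 0 < (p ^ n).coeff x) (x : G) :
    ∃ B : ℝ≥0, ∀ᶠ n in atTop,
      ((p ^ n).coeff x : ℝ≥0∞) / ((p ^ n).coeff 1 : ℝ≥0∞) ≤ B := by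
  obtain ⟨k, hk1, hkx, hk0⟩ := ((hp 1).and ((hp x⁻¹).and (eventually_gt_atTop 0))).exists
  obtain ⟨R, -, hR⟩ := exists_tendsto_coeff_add_div p hp hk0 hk1
  have hkx' : (0 : ℝ) < (p ^ k).coeff x⁻¹ := hkx
  refine ⟨Real.toNNReal ((R + 1) / (p ^ k).coeff x⁻¹), ?_⟩
  filter_upwards [(hR 1).eventually_lt_const (lt_add_one R), hp 1] with n hn hn1
  have hn1' : (0 : ℝ) < (p ^ n).coeff 1 := hn1
  rw [← ofReal_coe_div hn1]
  refine ENNReal.ofReal_le_ofReal ?_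
  have h1 : ((p ^ n).coeff x : ℝ) * (p ^ k).coeff x⁻¹ ≤ (p ^ (n + k)).coeff 1 := by
    have := coeff_mul_coeff_le (p ^ n) (p ^ k) x x⁻¹
    rw [mul_inv_cancel, ← pow_add] at this
    exact_mod_cast this
  rw [div_lt_iff₀ hn1'] at hn
  rw [div_le_div_iff₀ hn1' hkx']
  linarith

/-- The measure on a countable discrete space with prescribed point masses. -/
noncomputable def ofWeights {Γ : Type*} [MeasurableSpace Γ] (w : Γ → ℝ≥0∞) : Measure Γ :=
  Measure.sum fun x => w x • Measure.dirac x

theorem ofWeights_singleton {Γ : Type*} [MeasurableSpace Γ] [DiscreteMeasurableSpace Γ]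
    (w : Γ → ℝ≥0∞) (x : Γ) : ofWeights w {x} = w x := by
  rw [ofWeights, Measure.sum_apply _ (.of_discrete), tsum_eq_single x]
  · simp
  · intro y hy
    simp [hy]

instance sFinite_ofWeights {Γ : Type*} [Countable Γ] [MeasurableSpace Γ] (w : Γ → ℝ≥0∞) :
    SFinite (ofWeights w) := by
  unfold ofWeights
  infer_instance

theorem isNormalizedSolution_ofWeights {Γ : Type*} [Group Γ] [Countable Γ] [MeasurableSpace Γ]
    [DiscreteMeasurableSpace Γ] (μ : Measure Γ) [IsProbabilityMeasure μ]
    (hirr : IsIrreducible μ) (haper : period μ = 1) (hfin : (supp μ).Finite)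
    {w : Γ → ℝ≥0∞} {ψ : ℕ → ℕ} (hψ : Tendsto ψ atTop atTop)
    (hw : ∀ x, Tendsto (fun k => convPow μ (ψ k) {x} / convPow μ (ψ k) {1}) atTop (𝓝 (w x))) :
    IsNormalizedSolution μ (ofWeights w) := by
  have hp := eventually_coeff_pow_pos μ hfin hirr haper
  simp_rw [convPow_singleton μ hfin] at hw
  set p := toMonoidAlgebra μ hfin with hpdef
  have hwfin : ∀ x, w x < ∞ := fun x => by
    obtain ⟨B, hB⟩ := exists_eventually_coeff_div_le p hp x
    exact (le_of_tendsto (hw x) (hψ.eventually hB)).trans_lt ENNReal.coe_lt_top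
  obtain ⟨L, hL0, hL⟩ := exists_tendsto_coeff_succ_div p hp
  have hρ : spectralRad μ = ENNReal.ofReal L := by
    rw [spectralRad]
    simp_rw [convPow_singleton μ hfin]
    exact limsup_rpow_one_div_of_tendsto_ratio (by simp) (hp 1) hL0 (hL 1)
  refine ⟨fun x => by rw [ofWeights_singleton]; exact hwfin x, ?_, ?_⟩
  · rw [ofWeights_singleton]
    refine tendsto_nhds_unique (hw 1) (tendsto_const_nhds.congr' ?_)
    filter_upwards [hψ.eventually (hp 1)] with n hn
    exact (ENNReal.div_self (by simpa using hn.ne') ENNReal.coe_ne_top).symm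
  · refine Measure.ext_of_singleton fun x => ?_
    rw [mconv_singleton _ _ hfin, hρ, Measure.smul_apply, smul_eq_mul, ofWeights_singleton]
    simp_rw [ofWeights_singleton]
    have h1 : Tendsto (fun k => ∑ y ∈ hfin.toFinset, μ {y} *
        (((p ^ ψ k).coeff (y⁻¹ * x) : ℝ≥0∞) / ((p ^ ψ k).coeff 1 : ℝ≥0∞))) atTop
        (𝓝 (∑ y ∈ hfin.toFinset, μ {y} * w (y⁻¹ * x))) :=
      tendsto_finsetSum _ fun y _ =>
        ENNReal.Tendsto.const_mul (hw _) (Or.inr (measure_ne_top μ _))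
    have h2 : Tendsto (fun k => ENNReal.ofReal (((p ^ (ψ k + 1)).coeff x : ℝ) /
        (p ^ ψ k).coeff x) * (((p ^ ψ k).coeff x : ℝ≥0∞) / ((p ^ ψ k).coeff 1 : ℝ≥0∞))) atTop
        (𝓝 (ENNReal.ofReal L * w x)) :=
      ENNReal.Tendsto.mul (ENNReal.tendsto_ofReal ((hL x).comp hψ)) (Or.inr (hwfin x).ne) (hw x)
        (Or.inr ENNReal.ofReal_ne_top)
    -- Both sequences equal `μ^(n+1)(x) / μ^(n)(e)` along `ψ`, eventually.
    refine tendsto_nhds_unique h1 (h2.congr' ?_)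
    filter_upwards [hψ.eventually (hp x), hψ.eventually (hp 1)] with n hx h1
    rw [ofReal_coe_div hx, pow_succ', hpdef, coeff_toMonoidAlgebra_mul, ← hpdef,
      ← mul_div_assoc, ENNReal.div_mul_cancel (by simpa using hx.ne') ENNReal.coe_ne_top]
    simp only [div_eq_mul_inv, Finset.sum_mul, mul_assoc]

end RandomWalk

theorem theorem2 {Γ : Type*} [Group Γ] [Countable Γ] [MeasurableSpace Γ]
    [DiscreteMeasurableSpace Γ] (μ : Measure Γ) [IsProbabilityMeasure μ]
    (hirr : RandomWalk.IsIrreducible μ) (haper : RandomWalk.period μ = 1)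
    (hfin : (RandomWalk.supp μ).Finite)
    (P : Measure Γ → Prop)
    (hP : ∀ ν : Measure Γ, RandomWalk.IsSubseqLimit μ ν → P ν)
    (ν : Measure Γ) (hν : RandomWalk.IsNormalizedSolution μ ν) (hPν : P ν)
    (huniq : ∀ ν' : Measure Γ, RandomWalk.IsNormalizedSolution μ ν' → P ν' → ν' = ν) :
    ∀ x : Γ, Tendsto
      (fun n : ℕ => RandomWalk.convPow μ n {x} / RandomWalk.convPow μ n {1})
      atTop (𝓝 (ν {x})) := by
  rw [← tendsto_pi_nhds (f := fun (n : ℕ) (x : Γ) =>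
    RandomWalk.convPow μ n {x} / RandomWalk.convPow μ n {1}) (g := fun x => ν {x})]
  refine tendsto_of_subseq_tendsto fun ψ hψ => ?_
  -- (P) is only granted along strictly increasing indices.
  obtain ⟨χ, -, hχ⟩ := strictMono_subseq_of_tendsto_atTop hψ
  obtain ⟨w, -, φ, hφ, hw⟩ := isCompact_univ.isSeqCompact (x := fun n (x : Γ) =>
    RandomWalk.convPow μ (ψ (χ n)) {x} / RandomWalk.convPow μ (ψ (χ n)) {1})
    fun _ => Set.mem_univ _
  have hmono := hχ.comp hφ
  have hwx := tendsto_pi_nhds.1 hw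
  have hsol := RandomWalk.isNormalizedSolution_ofWeights μ hirr haper hfin
    hmono.tendsto_atTop hwx
  have hlim : RandomWalk.IsSubseqLimit μ (RandomWalk.ofWeights w) :=
    ⟨hsol.lt_top, _, hmono, fun x => by
      rw [RandomWalk.ofWeights_singleton]
      exact hwx x⟩
  have heq : w = fun x => ν {x} := by
    rw [← huniq _ hsol (hP _ hlim)]
    exact funext fun x => (RandomWalk.ofWeights_singleton w x).symm
  exact ⟨χ ∘ φ, heq ▸ hw⟩
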